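/- A set-theoretic solution of the Yang--Baxter equation is a pair $(X,r)$ with $X$ a non-empty set and $r\colon X\times X\to X\times X$, $r(x,y)=(\lambda_x(y),\rho_y(x))$, a map satisfying $(r\times\mathrm{id})(\mathrm{id}\times r)(r\times\mathrm{id})=(\mathrm{id}\times r)(r\times\mathrm{id})(\mathrm{id}\times r)$. It is non-degenerate if all $\lambda_x$ and $\rho_y$ are bijective; of Lyubashenko type if $r(x,y)=(\lambda(y),\rho(x))$ for two commuting permutations $\lambda,\rho$ of $X$; and simple if every solution $(Y,s)$ that is an epimorphic image of $(X,r)$ (i.e. admits a surjective $f\colon X\to Y$ with $(f\times f)r=s(f\times f)$) is isomorphic to $(X,r)$ or has $|Y|=1$. A skew left brace is a triple $(B,+,\circ)$ with $(B,+)$ and $(B,\circ)$ groups (not necessarily abelian) and $a\circ(b+c)=a\circ b-a+a\circ c$ for all $a,b,c\in B$. Put $\lambda_a(b)=-a+a\circ b$ and $\sigma_a(b)=-a+b+a$. The solution associated with $B$ is $r_B(a,b)=(\lambda_a(b),\lambda_a(b)^{-1}\circ a\circ b)$, where $^{-1}$ is the inverse in $(B,\circ)$. An ideal of $B$ is a subset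 $I$ that is a normal subgroup of both $(B,+)$ and $(B,\circ)$ and satisfies $\lambda_a(I)=I$ for all $a\in B$. An ideal $I$ acts transitively on a subset $X\subseteq B$ if $\sigma_a\lambda_b(X)\subseteq X$ for all $a,b\in I$ and for all $x,y\in X$ there are $a,b\in I$ with $\sigma_a\lambda_b(x)=y$. \textbf{Theorem.} Let $(X,r)$ be a finite non-degenerate solution of the Yang--Baxter equation that is not of Lyubashenko type. Then $(X,r)$ is simple if and only if there are a finite skew left brace $B$ and an injective map $X\to B$, by which we identify $X$ with a subset of $B$, such that $r$ is the restriction of $r_B$ to $X\times X$ and \begin{itemize} \item $X$ generates the group $(B,+)$; \item the ideal $V$ of $B$ generated by $\{x-y : x,y\in X\}$ is the smallest non-zero ideal of $B$, i.e. $V\neq 0$ and $V$ is contained in every non-zero ideal of $B$; \item the ideal $V$ acts transitively on $X$. \end{itemize} -/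

import Mathlib

universe u

namespace YangBaxter

/-! ### Set-theoretic solutions of the Yang-Baxter equation -/

/-- The map `r × id` on `X × X × X`. -/
def leftMap {X : Type*} (r : X × X → X × X) (t : X × X × X) : X × X × X :=
  ((r (t.1, t.2.1)).1, (r (t.1, t.2.1)).2, t.2.2)

/-- The map `id × r` on `X × X × X`. -/
def rightMap {X : Type*} (r : X × X → X × X) (t : X × X × X) : X × X × X :=
  (t.1, r t.2)

/-- `(X, r)` is a set-theoretic solution of the Yang-Baxter equation: `X` is non-empty and `r`
satisfies the braid equation. -/
structure IsSolution {X : Type*} (r : X × X → X × X) : Prop where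
  nonempty : Nonempty X
  braid : leftMap r ∘ rightMap r ∘ leftMap r = rightMap r ∘ leftMap r ∘ rightMap r

/-- Writing `r (x, y) = (λ_x y, ρ_y x)`, all the maps `λ_x` and `ρ_y` are bijective. -/
structure IsNondegenerate {X : Type*} (r : X × X → X × X) : Prop where
  bijective_left : ∀ x, Function.Bijective fun y => (r (x, y)).1
  bijective_right : ∀ y, Function.Bijective fun x => (r (x, y)).2

/-- `r (x, y) = (l y, p x)` for commuting permutations `l`, `p` of `X`. -/
def IsLyubashenko {X : Type*} (r : X × X → X × X) : Prop :=
  ∃ l p : Equiv.Perm X, Commute l p ∧ ∀ x y, r (x, y) = (l y, p x)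

/-- `f` is a morphism `(X, r) → (Y, s)`, that is `(f × f) r = s (f × f)`. -/
def IsMorphism {X Y : Type*} (r : X × X → X × X) (s : Y × Y → Y × Y) (f : X → Y) : Prop :=
  ∀ p, Prod.map f f (r p) = s (Prod.map f f p)

/-- `(X, r)` and `(Y, s)` are isomorphic. -/
def IsIsomorphic {X Y : Type*} (r : X × X → X × X) (s : Y × Y → Y × Y) : Prop :=
  ∃ e : X ≃ Y, IsMorphism r s e

/-- `(X, r)` is simple: each solution that is an epimorphic image of `(X, r)` is isomorphic to
`(X, r)` or has a singleton as its underlying set. -/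
def IsSimpleSolution {X : Type u} (r : X × X → X × X) : Prop :=
  ∀ (Y : Type u) (s : Y × Y → Y × Y), IsSolution s →
    ∀ f : X → Y, IsMorphism r s f → Function.Surjective f →
      IsIsomorphic r s ∨ Nonempty (Unique Y)

/-! ### Skew left braces -/

/-- A skew left brace: two group structures `(B, +)` and `(B, ∘)`, neither assumed commutative,
with `a ∘ (b + c) = a ∘ b - a + a ∘ c`. The operation `∘` is written as multiplication. -/
class SkewLeftBrace (B : Type*) extends AddGroup B, Group B where
  mul_add_eq : ∀ a b c : B, a * (b + c) = a * b - a + a * c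

variable {B : Type*} [SkewLeftBrace B]

/-- `λ_a (b) = -a + a ∘ b`. -/
def lam (a b : B) : B := -a + a * b

/-- `σ_a (b) = -a + b + a`. -/
def sig (a b : B) : B := -a + b + a

variable (B) in
/-- The solution `(B, r_B)` associated with `B`:
`r_B (a, b) = (λ_a (b), (λ_a (b))⁻¹ ∘ a ∘ b)`. -/
def braceSolution : B × B → B × B :=
  fun p => (lam p.1 p.2, (lam p.1 p.2)⁻¹ * p.1 * p.2)

/-- An additive subgroup `I` of `B` is an ideal: it is normal in `(B, +)`, `λ_a (I) = I` for all
`a`, and `I` is also a normal subgroup of `(B, ∘)`. -/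
structure IsIdeal (I : AddSubgroup B) : Prop where
  add_normal : I.Normal
  lam_image : ∀ a : B, lam a '' (I : Set B) = I
  mul_normal : ∃ N : Subgroup B, N.Normal ∧ (N : Set B) = I

/-- The ideal of `B` generated by a subset `S`: the intersection of all ideals containing `S`. -/
def idealClosure (S : Set B) : AddSubgroup B :=
  sInf {I : AddSubgroup B | IsIdeal I ∧ S ⊆ I}

/-- The action of `I` on the subset `X` of `B` is (defined and) transitive. Here the pair `(a, b)`
acts as `σ_a λ_b`; the subset `X` is invariant under all pairs in `I × I`, and any element of `X`
is sent to any other element of `X` by one of them. -/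
structure ActsTransitively (I : AddSubgroup B) (X : Set B) : Prop where
  invariant : ∀ a ∈ I, ∀ b ∈ I, ∀ x ∈ X, sig a (lam b x) ∈ X
  transitive : ∀ x ∈ X, ∀ y ∈ X, ∃ a ∈ I, ∃ b ∈ I, sig a (lam b x) = y

end YangBaxter

open YangBaxter

/-!
The two directions rest on the same picture: a solution `X` embedded in a finite skew left brace
`B` that it generates is invariant under all the maps `σ_a` and `λ_b`, and congruences of `X`
correspond to ideals of `B`.

*From the brace to simplicity.* Let `f : X → Y` be an epimorphism of solutions. Then `B` acts on
`Y` through both `λ` and `σ`. The elements of `B` that act trivially, in the sense of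
`IsBraceEmbedding.imageKer`, form an ideal that contains `x - x'` whenever `f x = f x'`. If this
ideal is zero, then `f` is injective. Otherwise it contains the ideal `V`, so the group by which `V`
acts on `X` acts trivially on `Y`; as `V` is transitive on `X`, the set `Y` is a singleton
(`IsBraceEmbedding.isSimpleSolution`).

*From simplicity to the brace.* The equality of both `λ` and `ρ` is a congruence, so a simple
solution that is not of Lyubashenko type is irretractable. The pairs `(λ_x, ρ_x)` generate a finite
group with a right action of `X` as in a matched pair of groups, and this makes `r` injective
(`IsBraiding.injective`). Hence the derived operation `σ_v (u) = λ_v ρ_y (u)`, `y = λ_u⁻¹ (v)`, is a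
rack operation on which the `λ_x` act by automorphisms. Let `L` be the group generated by the `λ_x`.
In a skew left brace `λ_{b + x} = k λ_{k⁻¹ (x)}` for `k = λ_b`; thus the additive group should act
from the right on `X` by `σ` and on `L` by `k ↦ k λ_{k⁻¹ (x)}`. These permutations of `X` and `L`
are taken as generators of the additive group of `B`, the group `L` acts on it by conjugation, and
`b ↦ λ_b`, the image of `1 ∈ L` under `b`, is the cocycle that defines the multiplication
(`IsDerivedPair.brace`). By construction no non-zero ideal of `B` acts trivially on `X`
(`IsDerivedPair.eq_bot_of_trivial`).

The orbits in `B` of the maps `σ_a λ_b`, for `a` and `b` in an ideal `I`, form a congruence of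
`(B, r_B)` (`SameOrbit.braceSolution`). By simplicity, a non-zero ideal `I` is therefore transitive
on `X`. Elements of an orbit are congruent modulo `I`, so `I` contains all the differences `x - y`
and hence the ideal generated by them.
-/

namespace YangBaxter

/-! ### Skew left braces -/

section Brace

variable {B : Type*} [SkewLeftBrace B]

theorem mul_eq_add_lam (a b : B) : a * b = a + lam a b := by simp [lam]

theorem lam_add (a b c : B) : lam a (b + c) = lam a b + lam a c := by
  simp [lam, SkewLeftBrace.mul_add_eq, sub_eq_add_neg, add_assoc]

theorem lam_zero (a : B) : lam a 0 = 0 := by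
  have h := lam_add a 0 0
  rw [add_zero] at h
  simpa using h

theorem lam_neg (a b : B) : lam a (-b) = -lam a b := by
  rw [eq_neg_iff_add_eq_zero, ← lam_add, neg_add_cancel, lam_zero]

theorem zero_eq_one : (0 : B) = 1 := by
  have h := mul_eq_add_lam (1 : B) 0
  rwa [one_mul, lam_zero, add_zero] at h

theorem lam_one (b : B) : lam 1 b = b := by
  rw [lam, one_mul, ← zero_eq_one, neg_zero, zero_add]

theorem lam_mul (a b c : B) : lam (a * b) c = lam a (lam b c) := by
  have h : a * b * c = a * b + lam a (lam b c) := by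
    rw [mul_assoc, mul_eq_add_lam b c, mul_eq_add_lam a, lam_add, ← add_assoc,
      ← mul_eq_add_lam a b]
  rw [lam, h, neg_add_cancel_left]

theorem lam_inv_lam (a b : B) : lam a⁻¹ (lam a b) = b := by
  rw [← lam_mul, inv_mul_cancel, lam_one]

theorem lam_lam_inv (a b : B) : lam a (lam a⁻¹ b) = b := by
  rw [← lam_mul, mul_inv_cancel, lam_one]

theorem lam_injective (a : B) : Function.Injective (lam a) :=
  Function.LeftInverse.injective (lam_inv_lam a)

theorem inv_eq_lam_inv_neg (a : B) : a⁻¹ = lam a⁻¹ (-a) := by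
  rw [lam_neg, lam, inv_mul_cancel, ← zero_eq_one, add_zero, neg_neg]

theorem add_eq_mul_lam_inv (a b : B) : a + b = a * lam a⁻¹ b := by
  rw [mul_eq_add_lam, lam_lam_inv]

theorem lam_sig (c a b : B) : lam c (sig a b) = sig (lam c a) (lam c b) := by
  simp only [sig, lam_add, lam_neg]

theorem sig_zero (b : B) : sig 0 b = b := by simp [sig]

theorem sig_sig (a b c : B) : sig a (sig b c) = sig (b + a) c := by
  simp [sig, add_assoc]

theorem lam_zero_left (b : B) : lam 0 b = b := by rw [zero_eq_one, lam_one]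

/-- The second component of `r_B` in terms of the two actions: it is
`λ_v⁻¹ (σ_v (a))` with `v = λ_a (b)`. -/
theorem braceSolution_snd (a b : B) :
    (braceSolution B (a, b)).2 = lam (lam a b)⁻¹ (sig (lam a b) a) := by
  have h : lam a b * lam (lam a b)⁻¹ (sig (lam a b) a) = a * b := by
    rw [← add_eq_mul_lam_inv, mul_eq_add_lam a b, sig, add_assoc, add_neg_cancel_left]
  simp only [braceSolution, mul_assoc]
  rw [← h, inv_mul_cancel_left]

/-! ### Ideals -/

namespace IsIdeal

variable {I : AddSubgroup B}

theorem lam_mem (hI : IsIdeal I) (a : B) {b : B} (hb : b ∈ I) : lam a b ∈ I := by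
  have h : lam a b ∈ lam a '' (I : Set B) := ⟨b, hb, rfl⟩
  rwa [hI.lam_image] at h

theorem conj_mem (hI : IsIdeal I) (a : B) {b : B} (hb : b ∈ I) : a * b * a⁻¹ ∈ I := by
  obtain ⟨N, hN, e⟩ := hI.mul_normal
  have h : ∀ x, x ∈ N ↔ x ∈ I := fun x => by rw [← SetLike.mem_coe, e, SetLike.mem_coe]
  exact (h _).1 (hN.conj_mem b ((h b).2 hb) a)

theorem mul_mem (hI : IsIdeal I) {a b : B} (ha : a ∈ I) (hb : b ∈ I) : a * b ∈ I := by
  rw [mul_eq_add_lam]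
  exact I.add_mem ha (hI.lam_mem a hb)

theorem inv_mem (hI : IsIdeal I) {a : B} (ha : a ∈ I) : a⁻¹ ∈ I := by
  rw [inv_eq_lam_inv_neg]
  exact hI.lam_mem _ (I.neg_mem ha)

theorem sig_mem (hI : IsIdeal I) (a : B) {b : B} (hb : b ∈ I) : sig a b ∈ I := by
  simpa [sig] using hI.add_normal.conj_mem b hb (-a)

/-- Elements of an ideal act trivially, through `λ`, on the additive quotient. -/
theorem neg_lam_add_mem (hI : IsIdeal I) {b : B} (hb : b ∈ I) (c : B) : -lam b c + c ∈ I := by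
  -- `c⁻¹ ∘ b ∘ c` lies in `I`, and `b + λ_b (c) = b ∘ c = c + λ_c (c⁻¹ ∘ b ∘ c)`
  have h1 : c⁻¹ * b * c ∈ I := by simpa using hI.conj_mem c⁻¹ hb
  have h2 : b + lam b c = c + lam c (c⁻¹ * b * c) := by
    rw [← mul_eq_add_lam, ← mul_eq_add_lam]
    simp [mul_assoc]
  have h3 : lam b c = -b + (c + lam c (c⁻¹ * b * c)) := by rw [← h2, neg_add_cancel_left]
  have h4 : -lam b c + c = -lam c (c⁻¹ * b * c) + sig c b := by
    rw [h3, sig]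
    simp [add_assoc, neg_add_rev]
  rw [h4]
  exact I.add_mem (I.neg_mem (hI.lam_mem _ h1)) (hI.sig_mem c hb)

/-- A criterion for ideals in which the normality in `(B, ∘)` is replaced by the triviality of the
action of `I` on the additive quotient. -/
theorem of_lam (hn : I.Normal) (hl : ∀ a, ∀ b ∈ I, lam a b ∈ I)
    (hc : ∀ b ∈ I, ∀ c, lam b c - c ∈ I) : IsIdeal I := by
  have hmul : ∀ {a b : B}, a ∈ I → b ∈ I → a * b ∈ I := by
    intro a b ha hb
    rw [mul_eq_add_lam]
    exact I.add_mem ha (hl a b hb)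
  have hinv : ∀ {a : B}, a ∈ I → a⁻¹ ∈ I := by
    intro a ha
    rw [inv_eq_lam_inv_neg]
    exact hl _ _ (I.neg_mem ha)
  refine ⟨hn, fun a => ?_, ?_⟩
  · ext b
    constructor
    · rintro ⟨c, hb, rfl⟩
      exact hl a c hb
    · intro hb
      exact ⟨lam a⁻¹ b, hl _ _ hb, lam_lam_inv a b⟩
  · refine ⟨{ carrier := I, mul_mem' := hmul, one_mem' := ?_, inv_mem' := hinv }, ⟨?_⟩, rfl⟩
    · rw [← zero_eq_one]
      exact I.zero_mem
    · intro b hb c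
      change b ∈ I at hb
      change c * b * c⁻¹ ∈ I
      -- `b ∘ d = d ∘ λ_d⁻¹ (-d + b ∘ d)` with `d = c⁻¹`
      have h1 : c * b * c⁻¹ = lam c (-c⁻¹ + b * c⁻¹) := by
        rw [lam_add, lam_neg, lam, lam, mul_inv_cancel, ← zero_eq_one, mul_assoc]
        simp
      rw [h1]
      refine hl _ _ ?_
      have h2 : -c⁻¹ + b * c⁻¹ = -c⁻¹ + (b + (lam b c⁻¹ - c⁻¹)) + - -c⁻¹ := by
        rw [mul_eq_add_lam]
        simp [sub_eq_add_neg, add_assoc]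
      rw [h2]
      exact hn.conj_mem _ (I.add_mem hb (hc b hb _)) _

theorem sInf {S : Set (AddSubgroup B)} (hS : ∀ I ∈ S, IsIdeal I) : IsIdeal (sInf S) := by
  refine of_lam ⟨fun b hb c => ?_⟩ (fun a b hb => ?_) (fun b hb c => ?_)
  all_goals
    rw [AddSubgroup.mem_sInf] at hb ⊢
    intro I hI
  · exact (hS I hI).add_normal.conj_mem b (hb I hI) c
  · exact (hS I hI).lam_mem a (hb I hI)
  · have h := I.neg_mem ((hS I hI).neg_lam_add_mem (hb I hI) c)
    have h2 : lam b c - c = c + -(-lam b c + c) + -c := by simp [sub_eq_add_neg]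
    rw [h2]
    exact (hS I hI).add_normal.conj_mem _ h c

end IsIdeal

theorem isIdeal_idealClosure (S : Set B) : IsIdeal (idealClosure S) :=
  IsIdeal.sInf fun _ h => h.1

theorem subset_idealClosure (S : Set B) : S ⊆ idealClosure S := by
  intro b hb
  rw [SetLike.mem_coe, idealClosure, AddSubgroup.mem_sInf]
  exact fun I hI => hI.2 hb

theorem idealClosure_le {S : Set B} {I : AddSubgroup B} (hI : IsIdeal I) (h : S ⊆ I) :
    idealClosure S ≤ I :=
  sInf_le ⟨hI, h⟩

/-! ### The orbits of an ideal -/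

/-- `q` lies in the orbit of `p` under the maps `σ_a λ_b` with `a` and `b` in `I`. -/
def SameOrbit (I : AddSubgroup B) (p q : B) : Prop :=
  ∃ a ∈ I, ∃ b ∈ I, sig a (lam b p) = q

namespace SameOrbit

variable {I : AddSubgroup B} {p p' q q' : B}

theorem refl (I : AddSubgroup B) (p : B) : SameOrbit I p p :=
  ⟨0, I.zero_mem, 0, I.zero_mem, by rw [lam_zero_left, sig_zero]⟩

theorem trans (hI : IsIdeal I) {t : B} (h : SameOrbit I p q) (h' : SameOrbit I q t) :
    SameOrbit I p t := by
  obtain ⟨a, ha, b, hb, rfl⟩ := h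
  obtain ⟨c, hc, d, hd, rfl⟩ := h'
  refine ⟨lam d a + c, I.add_mem (hI.lam_mem d ha) hc, d * b, hI.mul_mem hd hb, ?_⟩
  rw [lam_mul, lam_sig, sig_sig]

theorem symm (hI : IsIdeal I) (h : SameOrbit I p q) : SameOrbit I q p := by
  obtain ⟨a, ha, b, hb, rfl⟩ := h
  refine ⟨lam b⁻¹ (-a), hI.lam_mem _ (I.neg_mem ha), b⁻¹, hI.inv_mem hb, ?_⟩
  rw [← lam_sig, sig_sig, add_neg_cancel, sig_zero, lam_inv_lam]

theorem lam (hI : IsIdeal I) (c : B) (h : SameOrbit I p q) :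
    SameOrbit I (lam c p) (lam c q) := by
  obtain ⟨a, ha, b, hb, rfl⟩ := h
  refine ⟨YangBaxter.lam c a, hI.lam_mem c ha, c * b * c⁻¹, hI.conj_mem c hb, ?_⟩
  rw [lam_sig, lam_mul, lam_mul, lam_inv_lam]

theorem sig (hI : IsIdeal I) (c : B) (h : SameOrbit I p q) :
    SameOrbit I (sig c p) (sig c q) := by
  obtain ⟨a, ha, b, hb, rfl⟩ := h
  refine ⟨-YangBaxter.lam b c + c + YangBaxter.sig c a,
    I.add_mem (hI.neg_lam_add_mem hb c) (hI.sig_mem c ha), b, hb, ?_⟩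
  rw [lam_sig, sig_sig, sig_sig]
  congr 1
  simp [YangBaxter.sig, add_assoc]

/-- Elements of the same orbit are congruent modulo the ideal. -/
theorem neg_add_mem (hI : IsIdeal I) (h : SameOrbit I p q) : -p + q ∈ I := by
  obtain ⟨a, ha, b, hb, rfl⟩ := h
  have h1 := I.neg_mem (hI.neg_lam_add_mem hb p)
  have h2 : -p + YangBaxter.sig a (YangBaxter.lam b p) =
      YangBaxter.sig p (-a) + -(-YangBaxter.lam b p + p) + a := by
    simp [YangBaxter.sig, add_assoc]
  rw [h2]
  exact I.add_mem (I.add_mem (hI.sig_mem p (I.neg_mem ha)) h1) ha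

theorem exists_eq_mul (hI : IsIdeal I) (h : SameOrbit I p q) : ∃ v ∈ I, q = p * v :=
  ⟨YangBaxter.lam p⁻¹ (-p + q), hI.lam_mem _ (h.neg_add_mem hI), by
    rw [← add_eq_mul_lam_inv, add_neg_cancel_left]⟩

theorem of_lam_mem {v : B} (hv : v ∈ I) (q : B) : SameOrbit I q (YangBaxter.lam v q) :=
  ⟨0, I.zero_mem, v, hv, sig_zero _⟩

theorem lam_lam (hI : IsIdeal I) (hp : SameOrbit I p p') (hq : SameOrbit I q q') :
    SameOrbit I (YangBaxter.lam p q) (YangBaxter.lam p' q') := by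
  obtain ⟨v, hv, rfl⟩ := hp.exists_eq_mul hI
  rw [lam_mul]
  exact (hq.trans hI (of_lam_mem hv q')).lam hI p

theorem lam_inv_lam_inv (hI : IsIdeal I) (hp : SameOrbit I p p') (hq : SameOrbit I q q') :
    SameOrbit I (YangBaxter.lam p⁻¹ q) (YangBaxter.lam p'⁻¹ q') := by
  obtain ⟨v, hv, rfl⟩ := hp.exists_eq_mul hI
  rw [mul_inv_rev, lam_mul]
  exact (hq.lam hI p⁻¹).trans hI (of_lam_mem (hI.inv_mem hv) _)

theorem sig_sig (hI : IsIdeal I) (hp : SameOrbit I p p') (hq : SameOrbit I q q') :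
    SameOrbit I (YangBaxter.sig p q) (YangBaxter.sig p' q') := by
  have h : YangBaxter.sig p' q' = YangBaxter.sig (-p + p') (YangBaxter.sig p q') := by
    rw [YangBaxter.sig_sig, add_neg_cancel_left]
  rw [h]
  exact (hq.sig hI p).trans hI
    ⟨-p + p', hp.neg_add_mem hI, 0, I.zero_mem, by rw [lam_zero_left]⟩

/-- The orbits of an ideal form a congruence of the solution `(B, r_B)`. -/
theorem braceSolution (hI : IsIdeal I) (hp : SameOrbit I p p') (hq : SameOrbit I q q') :
    SameOrbit I (braceSolution B (p, q)).1 (braceSolution B (p', q')).1 ∧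
      SameOrbit I (braceSolution B (p, q)).2 (braceSolution B (p', q')).2 := by
  have h := hp.lam_lam hI hq
  refine ⟨h, ?_⟩
  rw [braceSolution_snd, braceSolution_snd]
  exact h.lam_inv_lam_inv hI (h.sig_sig hI hp)

end SameOrbit

end Brace

/-! ### Congruences of solutions -/

theorem IsSolution.of_surjective {X Y : Type*} {r : X × X → X × X} {s : Y × Y → Y × Y}
    (hr : IsSolution r) {f : X → Y} (hf : IsMorphism r s f) (hsurj : Function.Surjective f) :
    IsSolution s := by
  have hs : ∀ x y, s (f x, f y) = (f (r (x, y)).1, f (r (x, y)).2) :=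
    fun x y => (hf (x, y)).symm
  refine ⟨hr.nonempty.map f, ?_⟩
  funext ⟨a, b, c⟩
  obtain ⟨x, rfl⟩ := hsurj a
  obtain ⟨y, rfl⟩ := hsurj b
  obtain ⟨z, rfl⟩ := hsurj c
  have h := congrFun hr.braid (x, y, z)
  simp only [Function.comp, leftMap, rightMap, Prod.mk.injEq] at h
  simp only [Function.comp, leftMap, rightMap, hs, Prod.mk.injEq]
  exact ⟨congrArg f h.1, by rw [← h.2], by rw [← h.2]⟩

/-- A congruence of a finite simple solution is the equality or relates all elements. -/
theorem IsSimpleSolution.eq_or_forall {X : Type u} [Finite X] {r : X × X → X × X}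
    (hs : IsSimpleSolution r) (hr : IsSolution r) (c : Setoid X)
    (hc : ∀ x x' y y', c x x' → c y y' →
      c (r (x, y)).1 (r (x', y')).1 ∧ c (r (x, y)).2 (r (x', y')).2) :
    (∀ x y, c x y → x = y) ∨ ∀ x y, c x y := by
  let s : Quotient c × Quotient c → Quotient c × Quotient c := fun p =>
    Quotient.liftOn₂ p.1 p.2
      (fun x y => (Quotient.mk c (r (x, y)).1, Quotient.mk c (r (x, y)).2))
      (fun x y x' y' hx hy => Prod.ext (Quotient.sound (hc x x' y y' hx hy).1)
        (Quotient.sound (hc x x' y y' hx hy).2))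
  have hm : IsMorphism r s (Quotient.mk c) := fun _ => rfl
  rcases hs _ s (hr.of_surjective hm Quotient.mk_surjective) _ hm Quotient.mk_surjective with
    ⟨e, -⟩ | ⟨⟨h⟩⟩
  · left
    have hinj : Function.Injective (Quotient.mk c) :=
      (Nat.bijective_iff_surjective_and_card _).2
        ⟨Quotient.mk_surjective, Nat.card_congr e⟩ |>.injective
    exact fun x y hxy => hinj (Quotient.sound hxy)
  · right
    exact fun x y => Quotient.exact ((h.2 _).trans (h.2 _).symm)

/-! ### Solutions embedded in a skew left brace -/

/-- The map `i` identifies the solution `(X, r)` with a restriction of `(B, r_B)` to a generating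
set of `(B, +)`. -/
structure IsBraceEmbedding {X B : Type*} [SkewLeftBrace B] (r : X × X → X × X) (i : X → B) :
    Prop where
  injective : Function.Injective i
  isMorphism : IsMorphism r (braceSolution B) i
  closure_range : AddSubgroup.closure (Set.range i) = ⊤

namespace IsBraceEmbedding

variable {X B : Type*} [SkewLeftBrace B] {r : X × X → X × X} {i : X → B}

theorem map_fst (h : IsBraceEmbedding r i) (x y : X) : i (r (x, y)).1 = lam (i x) (i y) :=
  congrArg Prod.fst (h.isMorphism (x, y))

theorem map_snd (h : IsBraceEmbedding r i) (x y : X) :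
    i (r (x, y)).2 = lam (lam (i x) (i y))⁻¹ (sig (lam (i x) (i y)) (i x)) :=
  (congrArg Prod.snd (h.isMorphism (x, y))).trans (braceSolution_snd _ _)

variable [Finite B]

/-- Since `B` is finite, `X` generates `(B, +)` already as a monoid. -/
theorem add_induction (h : IsBraceEmbedding r i) {P : B → Prop} (zero : P 0)
    (add : ∀ b x, P b → P (b + i x)) (b : B) : P b := by
  have hb : b ∈ AddSubmonoid.closure (Set.range i) := by
    rw [← AddSubgroup.closure_toAddSubmonoid_of_finite, h.closure_range]
    trivial
  induction hb using AddSubmonoid.closure_induction_right with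
  | zero => exact zero
  | add_right b _ y hy ih =>
    obtain ⟨x, rfl⟩ := hy
    exact add b x ih

/-- The set `X` is invariant under all `σ_b`: for `v = λ_u (y)` in `X`, `σ_v (u) = λ_v ρ_y (u)`. -/
theorem sig_mem_range (h : IsBraceEmbedding r i) (hnd : IsNondegenerate r) (b : B) (x : X) :
    ∃ y, i y = sig b (i x) := by
  revert x
  refine h.add_induction (P := fun b => ∀ x, ∃ y, i y = sig b (i x)) ?_ ?_ b
  · exact fun x => ⟨x, (sig_zero _).symm⟩
  · intro b v ih x
    obtain ⟨u, hu⟩ := ih x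
    obtain ⟨y, hy⟩ := (hnd.bijective_left u).2 v
    refine ⟨(r (v, (r (u, y)).2)).1, ?_⟩
    rw [h.map_fst, h.map_snd, ← sig_sig, ← hu, ← h.map_fst, show (r (u, y)).1 = v from hy,
      lam_lam_inv]

/-- The set `X` is invariant under all `λ_b`: the elements `b` with this property form a
multiplicative submonoid, which is closed under `b ↦ b + x = b ∘ λ_b⁻¹ (x)` as well. -/
theorem lam_mem_range (h : IsBraceEmbedding r i) (b : B) (x : X) :
    ∃ y, i y = lam b (i x) := by
  let T : Submonoid B :=
    { carrier := {b | ∀ x, ∃ y, i y = lam b (i x)}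
      one_mem' := fun x => ⟨x, (lam_one _).symm⟩
      mul_mem' := fun {a b} ha hb x => by
        obtain ⟨y, hy⟩ := hb x
        obtain ⟨z, hz⟩ := ha y
        exact ⟨z, by rw [hz, hy, lam_mul]⟩ }
  have hX : ∀ x, i x ∈ T := fun x y => ⟨_, h.map_fst x y⟩
  suffices b ∈ T from this x
  refine h.add_induction (P := (· ∈ T)) ?_ (fun b x hb => ?_) b
  · rw [zero_eq_one]
    exact T.one_mem
  · have hinv : b⁻¹ ∈ T :=
      Submonoid.powers_le.2 hb
        ((isOfFinOrder_of_finite b).mem_powers_iff_mem_zpowers.2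
          (Subgroup.inv_mem _ (Subgroup.mem_zpowers b)))
    obtain ⟨y, hy⟩ := hinv x
    rw [add_eq_mul_lam_inv, ← hy]
    exact T.mul_mem hb (hX y)

/-- The set `X` also generates the multiplicative group. -/
theorem mul_induction (h : IsBraceEmbedding r i) {P : B → Prop} (one : P 1)
    (mul : ∀ b x, P b → P (b * i x)) (b : B) : P b := by
  refine h.add_induction (by rwa [zero_eq_one]) (fun b x hb => ?_) b
  obtain ⟨y, hy⟩ := h.lam_mem_range b⁻¹ x
  rw [add_eq_mul_lam_inv, ← hy]
  exact mul b y hb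

/-- The permutation of `X` induced by `λ_b`, as a function. -/
noncomputable def lamX (h : IsBraceEmbedding r i) (b : B) (x : X) : X :=
  (h.lam_mem_range b x).choose

theorem map_lamX (h : IsBraceEmbedding r i) (b : B) (x : X) : i (h.lamX b x) = lam b (i x) :=
  (h.lam_mem_range b x).choose_spec

/-- The permutation of `X` induced by `σ_b`, as a function. -/
noncomputable def sigX (h : IsBraceEmbedding r i) (hnd : IsNondegenerate r) (b : B) (x : X) : X :=
  (h.sig_mem_range hnd b x).choose

theorem map_sigX (h : IsBraceEmbedding r i) (hnd : IsNondegenerate r) (b : B) (x : X) :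
    i (h.sigX hnd b x) = sig b (i x) :=
  (h.sig_mem_range hnd b x).choose_spec

theorem lamX_one (h : IsBraceEmbedding r i) (x : X) : h.lamX 1 x = x :=
  h.injective (by rw [h.map_lamX, lam_one])

theorem lamX_mul (h : IsBraceEmbedding r i) (a b : B) (x : X) :
    h.lamX (a * b) x = h.lamX a (h.lamX b x) :=
  h.injective (by simp only [h.map_lamX, lam_mul])

theorem lamX_inv_lamX (h : IsBraceEmbedding r i) (a : B) (x : X) :
    h.lamX a⁻¹ (h.lamX a x) = x := by
  rw [← lamX_mul, inv_mul_cancel, lamX_one]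

theorem lamX_lamX_inv (h : IsBraceEmbedding r i) (a : B) (x : X) :
    h.lamX a (h.lamX a⁻¹ x) = x := by
  rw [← lamX_mul, mul_inv_cancel, lamX_one]

theorem lamX_apply (h : IsBraceEmbedding r i) (x y : X) : h.lamX (i x) y = (r (x, y)).1 :=
  h.injective (by rw [h.map_lamX, h.map_fst])

theorem sigX_zero (h : IsBraceEmbedding r i) (hnd : IsNondegenerate r) (x : X) :
    h.sigX hnd 0 x = x :=
  h.injective (by rw [h.map_sigX, sig_zero])

theorem sigX_add (h : IsBraceEmbedding r i) (hnd : IsNondegenerate r) (a b : B) (x : X) :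
    h.sigX hnd (a + b) x = h.sigX hnd b (h.sigX hnd a x) :=
  h.injective (by simp only [h.map_sigX, sig_sig])

theorem sigX_apply (h : IsBraceEmbedding r i) (hnd : IsNondegenerate r) (u y : X) :
    h.sigX hnd (i (r (u, y)).1) u = (r ((r (u, y)).1, (r (u, y)).2)).1 :=
  h.injective (by rw [h.map_sigX, h.map_fst (r (u, y)).1, h.map_snd, h.map_fst, lam_lam_inv])

/-- A non-zero ideal acts transitively on a simple solution, as soon as no non-zero ideal acts
trivially on it. -/
theorem actsTransitively {X B : Type u} [SkewLeftBrace B] {r : X × X → X × X} {i : X → B}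
    [Finite B] [Finite X] (h : IsBraceEmbedding r i) (hnd : IsNondegenerate r) (hr : IsSolution r)
    (hs : IsSimpleSolution r)
    (hfaithful : ∀ I : AddSubgroup B, IsIdeal I →
      (∀ b ∈ I, ∀ x, lam b (i x) = i x ∧ sig b (i x) = i x) → I = ⊥)
    {I : AddSubgroup B} (hI : IsIdeal I) (hI0 : I ≠ ⊥) :
    ActsTransitively I (Set.range i) := by
  have hinv : ∀ a b x, ∃ y, i y = sig a (lam b (i x)) := fun a b x =>
    ⟨h.sigX hnd a (h.lamX b x), by rw [h.map_sigX, h.map_lamX]⟩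
  let c : Setoid X :=
    { r := fun x y => SameOrbit I (i x) (i y)
      iseqv := ⟨fun _ => .refl I _, fun h => h.symm hI, fun h h' => h.trans hI h'⟩ }
  have hc : ∀ x x' y y', c x x' → c y y' →
      c (r (x, y)).1 (r (x', y')).1 ∧ c (r (x, y)).2 (r (x', y')).2 := by
    intro x x' y y' hx hy
    have hxy := SameOrbit.braceSolution hI hx hy
    have e := h.isMorphism (x, y)
    have e' := h.isMorphism (x', y')
    simp only [Prod.map] at e e'
    rwa [← e, ← e'] at hxy
  rcases hs.eq_or_forall hr c hc with htriv | htrans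
  · refine absurd (hfaithful I hI fun b hb x => ⟨?_, ?_⟩) hI0
    · obtain ⟨y, hy⟩ := hinv 0 b x
      rw [← sig_zero (lam b (i x)), ← hy, htriv x y ⟨0, I.zero_mem, b, hb, hy.symm⟩]
    · obtain ⟨y, hy⟩ := hinv b 0 x
      rw [lam_zero_left] at hy
      rw [← hy, htriv x y ⟨b, hb, 0, I.zero_mem, by rw [lam_zero_left, hy]⟩]
  · constructor
    · rintro a - b - _ ⟨x, rfl⟩
      exact hinv a b x
    · rintro _ ⟨x, rfl⟩ _ ⟨y, rfl⟩
      exact htrans x y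

end IsBraceEmbedding

/-! ### The ideal attached to an epimorphic image -/

namespace IsBraceEmbedding

variable {X B Y : Type*} [SkewLeftBrace B] [Finite B] {r : X × X → X × X} {i : X → B}
  {s : Y × Y → Y × Y} {f : X → Y}

theorem map_lamX_congr (h : IsBraceEmbedding r i) (hf : IsMorphism r s f) (b : B) {x x' : X}
    (hx : f x = f x') : f (h.lamX b x) = f (h.lamX b x') := by
  revert x x'
  refine h.mul_induction (P := fun b => ∀ {x x' : X}, f x = f x' →
    f (h.lamX b x) = f (h.lamX b x')) ?_ ?_ b
  · intro x x' hx
    rwa [lamX_one, lamX_one]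
  · intro b u ih x x' hx
    rw [lamX_mul, lamX_mul]
    apply ih
    have e := congrArg Prod.fst (hf (u, x))
    have e' := congrArg Prod.fst (hf (u, x'))
    simp only [Prod.map] at e e'
    rw [lamX_apply, lamX_apply, e, e', hx]

theorem map_lamX_congr_left (h : IsBraceEmbedding r i) (hf : IsMorphism r s f) {u u' : X}
    (hu : f u = f u') (x : X) : f (h.lamX (i u) x) = f (h.lamX (i u') x) := by
  have e := congrArg Prod.fst (hf (u, x))
  have e' := congrArg Prod.fst (hf (u', x))
  simp only [Prod.map] at e e'
  rw [lamX_apply, lamX_apply, e, e', hu]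

/-- The map `σ_v` is determined on `Y` by the images of its arguments: if `λ_u (y) = v`, then
`σ_v (u) = λ_v (ρ_y (u))`, and the image of `y` is determined by those of `u` and `v`. -/
theorem map_sigX_congr_gen (h : IsBraceEmbedding r i) (hnd : IsNondegenerate r)
    (hf : IsMorphism r s f) {u u' v v' : X} (hu : f u = f u') (hv : f v = f v') :
    f (h.sigX hnd (i v) u) = f (h.sigX hnd (i v') u') := by
  obtain ⟨y, rfl⟩ := (hnd.bijective_left u).2 v
  obtain ⟨y', rfl⟩ := (hnd.bijective_left u').2 v'
  have hy : f y = f y' := by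
    have e : f (h.lamX (i u) y) = f (h.lamX (i u) y') := by
      rw [h.map_lamX_congr_left hf hu y', lamX_apply, lamX_apply]
      exact hv
    have e2 := h.map_lamX_congr hf (i u)⁻¹ e
    rwa [lamX_inv_lamX, lamX_inv_lamX] at e2
  have e : ∀ p, (f (r p).1, f (r p).2) = s (f p.1, f p.2) := hf
  have hr2 : ∀ p p' : X × X, f p.1 = f p'.1 → f p.2 = f p'.2 →
      f (r p).1 = f (r p').1 ∧ f (r p).2 = f (r p').2 := by
    intro p p' h1 h2
    have e3 := (e p).trans ((by rw [h1, h2] : s (f p.1, f p.2) = s (f p'.1, f p'.2)).trans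
      (e p').symm)
    exact Prod.mk.inj e3
  simp only [sigX_apply]
  have h1 := hr2 (u, y) (u', y') hu hy
  exact (hr2 _ _ h1.1 h1.2).1

theorem map_sigX_congr (h : IsBraceEmbedding r i) (hnd : IsNondegenerate r)
    (hf : IsMorphism r s f) (b : B) {x x' : X} (hx : f x = f x') :
    f (h.sigX hnd b x) = f (h.sigX hnd b x') := by
  revert x x'
  refine h.add_induction (P := fun b => ∀ {x x' : X}, f x = f x' →
    f (h.sigX hnd b x) = f (h.sigX hnd b x')) ?_ ?_ b
  · intro x x' hx
    rwa [sigX_zero, sigX_zero]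
  · intro b v ih x x' hx
    rw [sigX_add, sigX_add]
    exact h.map_sigX_congr_gen hnd hf (ih hx) rfl

/-- The elements `b` and `c` act in the same way, through `λ`, on the image of `f`. -/
def LamRel (h : IsBraceEmbedding r i) (f : X → Y) (b c : B) : Prop :=
  ∀ x, f (h.lamX b x) = f (h.lamX c x)

/-- The relation is compatible with right translations by elements of `X` with the same image:
`b + x = b ∘ λ_b⁻¹ (x)`, and the image of `λ_b⁻¹ (x)` is determined by the actions on `Y`. -/
theorem LamRel.add_gen {h : IsBraceEmbedding r i} (hf : IsMorphism r s f) {b c : B}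
    (hbc : h.LamRel f b c) {x x' : X} (hx : f x = f x') : h.LamRel f (b + i x) (c + i x') := by
  intro z
  rw [add_eq_mul_lam_inv, add_eq_mul_lam_inv, ← h.map_lamX, ← h.map_lamX, lamX_mul, lamX_mul]
  have e : f (h.lamX b⁻¹ x) = f (h.lamX c⁻¹ x') := by
    have e1 : f (h.lamX b (h.lamX b⁻¹ x)) = f (h.lamX b (h.lamX c⁻¹ x')) := by
      rw [hbc (h.lamX c⁻¹ x'), lamX_lamX_inv, lamX_lamX_inv, hx]
    have e2 := h.map_lamX_congr hf b⁻¹ e1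
    rwa [lamX_inv_lamX, lamX_inv_lamX] at e2
  rw [← hbc]
  exact h.map_lamX_congr hf b (h.map_lamX_congr_left hf e z)

theorem LamRel.add_right {h : IsBraceEmbedding r i} (hf : IsMorphism r s f) {b c : B}
    (hbc : h.LamRel f b c) (d : B) : h.LamRel f (b + d) (c + d) := by
  refine h.add_induction (P := fun d => h.LamRel f (b + d) (c + d)) ?_ ?_ d
  · rwa [add_zero, add_zero]
  · intro d x ih
    rw [← add_assoc, ← add_assoc]
    exact ih.add_gen hf rfl

/-- The additive subgroup of the elements that act trivially on `Y`, through `σ`, and whose right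
translations act trivially on the quotient of `B` by the relation of acting in the same way on `Y`
through `λ`. It is the kernel of the action of `(B, +)` on these two sets. -/
def imageKer (h : IsBraceEmbedding r i) (hnd : IsNondegenerate r) (f : X → Y) :
    AddSubgroup B where
  carrier := {b | (∀ x, f (h.sigX hnd b x) = f x) ∧ ∀ c, h.LamRel f (c + b) c}
  zero_mem' := ⟨fun x => by rw [sigX_zero], fun c x => by rw [add_zero]⟩
  add_mem' := by
    rintro a b ⟨ha, ha'⟩ ⟨hb, hb'⟩
    refine ⟨fun x => by rw [sigX_add, hb, ha], fun c x => ?_⟩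
    rw [← add_assoc, hb' (c + a) x, ha' c x]
  neg_mem' := by
    rintro b ⟨hb, hb'⟩
    refine ⟨fun x => ?_, fun c x => ?_⟩
    · rw [← hb (h.sigX hnd (-b) x), ← sigX_add, neg_add_cancel, sigX_zero]
    · rw [← hb' (c + -b) x, add_assoc, neg_add_cancel, add_zero]

variable (h : IsBraceEmbedding r i) (hnd : IsNondegenerate r)

theorem mem_imageKer {b : B} : b ∈ h.imageKer hnd f ↔
    (∀ x, f (h.sigX hnd b x) = f x) ∧ ∀ c, h.LamRel f (c + b) c :=
  Iff.rfl

theorem imageKer_normal (hf : IsMorphism r s f) : (h.imageKer hnd f).Normal := by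
  refine ⟨fun b hb d => ?_⟩
  rw [mem_imageKer] at hb ⊢
  obtain ⟨hb, hb'⟩ := hb
  refine ⟨fun x => ?_, fun c => ?_⟩
  · rw [sigX_add, sigX_add]
    have e := h.map_sigX_congr hnd hf (-d) (hb (h.sigX hnd d x))
    rwa [← h.sigX_add hnd d (-d), add_neg_cancel, sigX_zero] at e
  · have e := (hb' (c + d)).add_right hf (-d)
    rw [add_assoc c d (-d), add_neg_cancel, add_zero] at e
    simpa only [add_assoc] using e

theorem sub_mem_imageKer (hf : IsMorphism r s f) {x x' : X}
    (hx : f x = f x') : i x - i x' ∈ h.imageKer hnd f := by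
  rw [mem_imageKer]
  refine ⟨fun z => ?_, fun c => ?_⟩
  · rw [sub_eq_add_neg, sigX_add]
    have e := h.map_sigX_congr hnd hf (-i x') (h.map_sigX_congr_gen hnd hf (rfl : f z = f z) hx)
    rwa [← h.sigX_add hnd (i x'), add_neg_cancel, sigX_zero] at e
  · have e2 := LamRel.add_gen (h := h) hf (b := c) (c := c) (fun _ => rfl) hx
    have e3 := e2.add_right hf (-i x')
    rw [add_assoc c (i x'), add_neg_cancel, add_zero] at e3
    simpa only [sub_eq_add_neg, add_assoc] using e3

theorem lam_mem_imageKer (hf : IsMorphism r s f) (d : B) {b : B} (hb : b ∈ h.imageKer hnd f) :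
    lam d b ∈ h.imageKer hnd f := by
  rw [mem_imageKer] at hb ⊢
  obtain ⟨hb, hb'⟩ := hb
  refine ⟨fun x => ?_, fun c x => ?_⟩
  · have e : h.sigX hnd (lam d b) x = h.lamX d (h.sigX hnd b (h.lamX d⁻¹ x)) :=
      h.injective (by rw [h.map_sigX, h.map_lamX, h.map_sigX, h.map_lamX, lam_sig, lam_lam_inv])
    rw [e, h.map_lamX_congr hf d (hb _), lamX_lamX_inv]
  · -- `c + λ_d (b) = d ∘ (u + b)` for `u = d⁻¹ ∘ c`
    have e : c + lam d b = d * (d⁻¹ * c + b) := by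
      rw [mul_eq_add_lam d, lam_add, ← add_assoc, ← mul_eq_add_lam, mul_inv_cancel_left]
    rw [e, lamX_mul, h.map_lamX_congr hf d (hb' (d⁻¹ * c) x), ← lamX_mul, mul_inv_cancel_left]

theorem lam_sub_mem_imageKer (hf : IsMorphism r s f) {b : B}
    (hb : b ∈ h.imageKer hnd f) (c : B) :
    lam b c - c ∈ h.imageKer hnd f := by
  refine h.add_induction (P := fun c => lam b c - c ∈ h.imageKer hnd f) ?_ ?_ c
  · rw [lam_zero, sub_zero]
    exact AddSubgroup.zero_mem _
  · intro c x ih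
    have e : f (h.lamX b x) = f x := by
      have e1 := ((h.mem_imageKer hnd).1 hb).2 0 x
      rwa [zero_add, zero_eq_one, lamX_one] at e1
    have e2 := h.sub_mem_imageKer hnd hf e
    rw [h.map_lamX] at e2
    have e3 : lam b (c + i x) - (c + i x) =
        (lam b c - c) + (c + (lam b (i x) - i x) + -c) := by
      simp [lam_add, sub_eq_add_neg, add_assoc]
    rw [e3]
    exact AddSubgroup.add_mem _ ih ((h.imageKer_normal hnd hf).conj_mem _ e2 c)

theorem isIdeal_imageKer (hf : IsMorphism r s f) : IsIdeal (h.imageKer hnd f) :=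
  .of_lam (h.imageKer_normal hnd hf) (fun a _ hb => h.lam_mem_imageKer hnd hf a hb)
    (fun _ hb c => h.lam_sub_mem_imageKer hnd hf hb c)

/-- If the ideal generated by the differences of elements of `X` is the smallest non-zero ideal and
acts transitively on `X`, then the solution is simple. -/
theorem isSimpleSolution {X : Type u} {r : X × X → X × X} {i : X → B}
    (h : IsBraceEmbedding r i) (hnd : IsNondegenerate r)
    (hleast : ∀ I : AddSubgroup B, IsIdeal I → I ≠ ⊥ →
      idealClosure {b : B | ∃ x y : X, b = i x - i y} ≤ I)
    (htrans : ActsTransitively (idealClosure {b : B | ∃ x y : X, b = i x - i y}) (Set.range i)) :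
    IsSimpleSolution r := by
  intro Y s hs f hf hsurj
  by_cases hK : h.imageKer hnd f = ⊥
  · left
    have hinj : Function.Injective f := by
      intro x x' hx
      have e := h.sub_mem_imageKer hnd hf hx
      rw [hK, AddSubgroup.mem_bot, sub_eq_zero] at e
      exact h.injective e
    exact ⟨Equiv.ofBijective f ⟨hinj, hsurj⟩, hf⟩
  · right
    have hle := hleast _ (h.isIdeal_imageKer hnd hf) hK
    have hconst : ∀ x y, f x = f y := by
      intro x y
      obtain ⟨a, ha, b, hb, e⟩ := htrans.transitive (i x) ⟨x, rfl⟩ (i y) ⟨y, rfl⟩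
      have hy : h.sigX hnd a (h.lamX b x) = y := h.injective (by rw [h.map_sigX, h.map_lamX, e])
      have e1 := ((h.mem_imageKer hnd).1 (hle hb)).2 0 x
      rw [zero_add, zero_eq_one, lamX_one] at e1
      rw [← hy, ((h.mem_imageKer hnd).1 (hle ha)).1, e1]
    obtain ⟨y₀⟩ := hs.nonempty
    refine ⟨⟨⟨y₀⟩, fun y => ?_⟩⟩
    obtain ⟨x, rfl⟩ := hsurj y
    obtain ⟨x₀, rfl⟩ := hsurj y₀
    exact hconst x x₀

end IsBraceEmbedding

/-! ### Irretractable solutions -/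

/-- A non-degenerate solution in terms of its components: permutations `l x = λ_x` and
`q y = ρ_y` of `X` that satisfy the three components of the braid equation. -/
structure IsBraiding {X : Type*} (l q : X → Equiv.Perm X) : Prop where
  left : ∀ x y, l (l x y) * l (q y x) = l x * l y
  mid : ∀ x y z, q (l (q y x) z) (l x y) = l (q (l y z) x) (q z y)
  right : ∀ x y z, q z (q y x) = q (q z y) (q (l y z) x)

theorem IsBraiding.left_apply {X : Type*} {l q : X → Equiv.Perm X} (h : IsBraiding l q)
    (x y z : X) : l (l x y) (l (q y x) z) = l x (l y z) :=
  DFunLike.congr_fun (h.left x y) z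

/-- `X` is irretractable: an element is determined by the permutations `λ_x` and `ρ_x`. -/
def IsIrretractable {X : Type*} (l q : X → Equiv.Perm X) : Prop :=
  ∀ x y, l x = l y → q x = q y → x = y

section Group

variable {X : Type*} (l q : X → Equiv.Perm X)

/-- The pair `(λ_x, ρ_x)`, in the group in which the multiplication of the second component is
reversed. -/
def genPair (x : X) : Equiv.Perm X × (Equiv.Perm X)ᵐᵒᵖ := (l x, MulOpposite.op (q x))

/-- The right action of `p` in the matched pair of groups attached to the solution. If `h` is
`genPair x`, the value is `genPair (ρ_p x)`. -/
def rightAct (h : Equiv.Perm X × (Equiv.Perm X)ᵐᵒᵖ) (p : X) :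
    Equiv.Perm X × (Equiv.Perm X)ᵐᵒᵖ :=
  (genPair l q (h.1 p))⁻¹ * h * genPair l q p

/-- The letters `λ_x (p₁), λ_{x'} (p₂), …` with `x' = ρ_{p₁} (x)` and so on, for a word
`p₁ p₂ …`. -/
def outWord : X → List X → List X
  | _, [] => []
  | x, p :: m => l x p :: outWord (q p x) m

/-- The element `… ρ_{p₂} ρ_{p₁} (x)` for a word `p₁ p₂ …`. -/
def endLetter (x : X) (m : List X) : X := m.foldl (fun x p => q p x) x

variable {l q}

theorem IsIrretractable.genPair_injective (hi : IsIrretractable l q) :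
    Function.Injective (genPair l q) := fun x y h =>
  hi x y (congrArg Prod.fst h) (MulOpposite.op_injective (congrArg Prod.snd h))

theorem IsBraiding.genPair_mul (h : IsBraiding l q) (x y : X) :
    genPair l q (l x y) * genPair l q (q y x) = genPair l q x * genPair l q y := by
  refine Prod.ext (h.left x y) (MulOpposite.unop_injective ?_)
  ext z
  exact (h.right z x y).symm

theorem endLetter_eq (x : X) (m : List X) :
    endLetter q x m = (m.map (genPair l q)).prod.2.unop x := by
  induction m generalizing x with
  | nil => rfl
  | cons p m ih => exact ih (q p x)

theorem IsBraiding.prod_outWord (h : IsBraiding l q) (x : X) (m : List X) :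
    ((outWord l q x m).map (genPair l q)).prod * genPair l q (endLetter q x m) =
      genPair l q x * (m.map (genPair l q)).prod := by
  induction m generalizing x with
  | nil => simp [outWord, endLetter]
  | cons p m ih =>
    simp only [outWord, List.map_cons, List.prod_cons, mul_assoc]
    rw [show endLetter q x (p :: m) = endLetter q (q p x) m from rfl, ih, ← mul_assoc,
      h.genPair_mul, mul_assoc]

theorem IsBraiding.rightAct_mul (h : IsBraiding l q) (g : Equiv.Perm X × (Equiv.Perm X)ᵐᵒᵖ)
    (x p : X) : rightAct l q (g * genPair l q x) p =
      rightAct l q g (l x p) * genPair l q (q p x) := by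
  have e := h.genPair_mul x p
  rw [← eq_inv_mul_iff_mul_eq] at e
  rw [e]
  simp only [rightAct, mul_assoc, mul_inv_cancel_left]
  rfl

/-- The cocycle rule for the right action of a word on a product. -/
theorem IsBraiding.foldl_rightAct_mul (h : IsBraiding l q)
    (g : Equiv.Perm X × (Equiv.Perm X)ᵐᵒᵖ) (x : X) (m : List X) :
    m.foldl (rightAct l q) (g * genPair l q x) =
      (outWord l q x m).foldl (rightAct l q) g * genPair l q (endLetter q x m) := by
  induction m generalizing g x with
  | nil => rfl
  | cons p m ih =>
    rw [List.foldl_cons, h.rightAct_mul, ih]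
    rfl

/-- A word that is trivial in the group generated by the pairs acts trivially, from the right, on
this group. -/
theorem IsBraiding.foldl_rightAct (h : IsBraiding l q) {g : Equiv.Perm X × (Equiv.Perm X)ᵐᵒᵖ}
    (hg : g ∈ Submonoid.closure (Set.range (genPair l q))) {m : List X}
    (hm : (m.map (genPair l q)).prod = 1) : m.foldl (rightAct l q) g = g := by
  induction hg using Submonoid.closure_induction_right generalizing m with
  | one =>
    have key : ∀ m : List X, m.foldl (rightAct l q) 1 = 1 := by
      intro m
      induction m with
      | nil => rfl
      | cons p m ih =>
        rw [List.foldl_cons, show rightAct l q 1 p = 1 by simp [rightAct], ih]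
    exact key m
  | mul_right g _ y hy ih =>
    obtain ⟨x, rfl⟩ := hy
    have h1 : endLetter q x m = x := by
      rw [endLetter_eq (l := l), hm]
      rfl
    have h2 := h.prod_outWord x m
    rw [h1, hm, mul_one, mul_eq_right] at h2
    rw [h.foldl_rightAct_mul, h1, ih h2]

/-- A finite irretractable non-degenerate solution is injective. -/
theorem IsBraiding.injective [Finite X] (h : IsBraiding l q) (hi : IsIrretractable l q)
    {u u' y y' : X} (h1 : l u y = l u' y') (h2 : q y u = q y' u') : u = u' ∧ y = y' := by
  have hu : u = u' := by
    have : Finite (Equiv.Perm X)ᵐᵒᵖ := Finite.of_equiv _ MulOpposite.opEquiv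
    -- the right action of `v = λ_u (y)` sends the inverse of `u` to that of `ρ_y (u)`
    have key : ∀ u y : X, rightAct l q (genPair l q u)⁻¹ (l u y) = (genPair l q (q y u))⁻¹ := by
      intro u y
      have e := h.genPair_mul u y
      rw [← eq_inv_mul_iff_mul_eq] at e
      rw [e]
      simp [rightAct, genPair, mul_assoc]
    -- and this action is injective, as some power of it is the identity
    have hmem : ∀ x, (genPair l q x)⁻¹ ∈ Submonoid.closure (Set.range (genPair l q)) := by
      intro x
      have hx : genPair l q x ∈ Subgroup.closure (Set.range (genPair l q)) :=
        Subgroup.subset_closure ⟨x, rfl⟩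
      rw [← Subgroup.closure_toSubmonoid_of_finite]
      exact Subgroup.inv_mem _ hx
    obtain ⟨k, hk, hk1⟩ := (isOfFinOrder_iff_pow_eq_one).1
      (isOfFinOrder_of_finite (genPair l q (l u y)))
    obtain ⟨k, rfl⟩ := Nat.exists_eq_succ_of_ne_zero hk.ne'
    have hw : ((List.replicate (k + 1) (l u y)).map (genPair l q)).prod = 1 := by
      rw [List.map_replicate, List.prod_replicate, hk1]
    have e := h.foldl_rightAct (hmem u) hw
    have e' := h.foldl_rightAct (hmem u') hw
    rw [List.replicate_succ, List.foldl_cons, key] at e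
    rw [List.replicate_succ, List.foldl_cons, h1, key, ← h2, ← h1, e] at e'
    exact hi.genPair_injective (inv_injective e')
  subst hu
  exact ⟨rfl, (l u).injective h1⟩

/-- The diagonal map `x ↦ λ_x⁻¹ (x)` of an irretractable solution is injective: if
`λ_x (y) = x` then `r (x, y) = (x, y)`, hence `x = ρ_y⁻¹ (y)`. -/
theorem IsBraiding.diag_injective (h : IsBraiding l q) (hi : IsIrretractable l q) :
    Function.Injective fun x => (l x).symm x := by
  have key : ∀ x y, l x y = x → q y x = y := by
    intro x y hxy
    have e := h.genPair_mul x y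
    rw [hxy] at e
    exact hi.genPair_injective (mul_left_cancel e)
  intro x x' hx
  have e := key x ((l x).symm x) (by simp)
  have e' := key x' ((l x').symm x') (by simp)
  simp only at hx
  rw [← hx] at e'
  exact (q _).injective (e.trans e'.symm)

end Group

/-! ### The derived rack -/

section Rack

variable {X : Type*} {l q : X → Equiv.Perm X}

/-- The derived operation `σ_v (u) = λ_v ρ_y (u)` with `y = λ_u⁻¹ (v)`. -/
def derived (l q : X → Equiv.Perm X) (v u : X) : X := l v (q ((l u).symm v) u)

theorem derived_apply (u y : X) : derived l q (l u y) u = l (l u y) (q y u) := by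
  simp [derived]

/-- Each `λ_a` is an automorphism of the derived operation. -/
theorem IsBraiding.l_derived (h : IsBraiding l q) (a v u : X) :
    l a (derived l q v u) = derived l q (l a v) (l a u) := by
  obtain ⟨y, rfl⟩ := (l u).surjective v
  have e1 : l a (l u y) = l (l a u) (l (q u a) y) := (h.left_apply a u y).symm
  have e2 : l a (l (l u y) (q y u)) =
      l (l a (l u y)) (l (q (l u y) a) (q y u)) := (h.left_apply a _ _).symm
  rw [derived_apply, e2, e1, derived_apply, h.mid]

/-- Self-distributivity of the derived operation. -/
theorem IsBraiding.derived_derived (h : IsBraiding l q) (w v u : X) :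
    derived l q w (derived l q v u) = derived l q (derived l q w v) (derived l q w u) := by
  obtain ⟨y, rfl⟩ := (l u).surjective v
  obtain ⟨m, rfl⟩ := (l (l u y)).surjective w
  obtain ⟨z, rfl⟩ := (l (q y u)).surjective m
  have hw : l (l u y) (l (q y u) z) = l u (l y z) := h.left_apply u y z
  -- both sides equal `λ_v λ_{λ_{ρ_y u} z} ρ_z ρ_y u`
  have e1 : derived l q (l (l u y) (l (q y u) z)) (derived l q (l u y) u) =
      l (l u y) (l (l (q y u) z) (q z (q y u))) := by
    rw [derived_apply, ← h.l_derived, derived_apply]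
  have e2 : derived l q (l (l u y) (l (q y u) z)) (l u y) =
      l (l u (l y z)) (l (q (l y z) u) (q z y)) := by
    rw [derived_apply, hw, h.mid]
  have e3 : derived l q (l (l u y) (l (q y u) z)) u =
      l (l u (l y z)) (q (l y z) u) := by
    rw [hw, derived_apply]
  rw [e1, e2, e3, ← h.l_derived, derived_apply, ← h.right, ← h.mid, ← hw]
  exact (h.left_apply (l u y) (l (q y u) z) _).symm

theorem IsBraiding.derived_injective [Finite X] (h : IsBraiding l q) (hi : IsIrretractable l q)
    (v : X) : Function.Injective (derived l q v) := by
  intro u u' e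
  exact (h.injective hi (y := (l u).symm v) (y' := (l u').symm v) (by simp)
    ((l v).injective e)).1

theorem q_eq_derived (u x : X) : q x u = (l (l u x)).symm (derived l q (l u x) u) := by
  rw [derived_apply, Equiv.symm_apply_apply]

end Rack

/-! ### Construction of a finite skew left brace -/

/-- A group `A` with an action `φ` of a group `L` by endomorphisms and a map `k : A → L` with
`k (a φ_{k a} (b)) = k a * k b` is a skew left brace, with `A` as additive group and
`a ∘ b = a φ_{k a} (b)`. -/
abbrev skewLeftBraceOfCocycle {A L : Type*} [Group A] [Group L] (φ : L → A →* A)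
    (φ_one : ∀ a, φ 1 a = a) (φ_mul : ∀ x y a, φ (x * y) a = φ x (φ y a)) (k : A → L)
    (hk : ∀ a b, k (a * φ (k a) b) = k a * k b) : SkewLeftBrace (Additive A) :=
  have k_one : k 1 = 1 := by
    have e := hk 1 1
    rwa [map_one, mul_one, left_eq_mul] at e
  have mul_inv : ∀ a, a * φ (k a) (φ (k a)⁻¹ a⁻¹) = 1 := fun a => by
    rw [← φ_mul, mul_inv_cancel, φ_one, mul_inv_cancel]
  have k_inv : ∀ a, k (φ (k a)⁻¹ a⁻¹) = (k a)⁻¹ := fun a => by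
    rw [eq_comm, inv_eq_iff_mul_eq_one, ← hk, mul_inv, k_one]
  { toAddGroup := Additive.addGroup
    mul := fun a b => .ofMul (a.toMul * φ (k a.toMul) b.toMul)
    one := .ofMul 1
    inv := fun a => .ofMul (φ (k a.toMul)⁻¹ a.toMul⁻¹)
    mul_assoc := fun a b c => congrArg Additive.ofMul <| by
      change a.toMul * φ (k a.toMul) b.toMul *
        φ (k (a.toMul * φ (k a.toMul) b.toMul)) c.toMul =
          a.toMul * φ (k a.toMul) (b.toMul * φ (k b.toMul) c.toMul)
      rw [hk, φ_mul, map_mul, mul_assoc]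
    one_mul := fun a => congrArg Additive.ofMul <| by
      change 1 * φ (k 1) a.toMul = a.toMul
      rw [one_mul, k_one, φ_one]
    mul_one := fun a => congrArg Additive.ofMul <| by
      change a.toMul * φ (k a.toMul) 1 = a.toMul
      rw [map_one, mul_one]
    inv_mul_cancel := fun a => congrArg Additive.ofMul <| by
      change φ (k a.toMul)⁻¹ a.toMul⁻¹ * φ (k (φ (k a.toMul)⁻¹ a.toMul⁻¹)) a.toMul = 1
      rw [k_inv, ← map_mul, inv_mul_cancel, map_one]
    mul_add_eq := fun a b c => congrArg Additive.ofMul <| by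
      change a.toMul * φ (k a.toMul) (b.toMul * c.toMul) =
        a.toMul * φ (k a.toMul) b.toMul / a.toMul * (a.toMul * φ (k a.toMul) c.toMul)
      simp only [map_mul, ← mul_assoc, div_mul_cancel] }

/-- The maps `λ_x` and the derived operation `σ_v` of a non-degenerate solution, with the relations
between them: `σ` is a rack operation on which the `λ_x` act by automorphisms, and `λ` is compatible
with the relation `u + v = v + σ_v (u)`. -/
structure IsDerivedPair {X : Type*} (l σ : X → Equiv.Perm X) : Prop where
  equivariant : ∀ a v u, l a (σ v u) = σ (l a v) (l a u)
  rack : ∀ w v u, σ w (σ v u) = σ (σ w v) (σ w u)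
  comm : ∀ u v, l u * l ((l u).symm v) = l v * l ((l v).symm (σ v u))
  diag_injective : Function.Injective fun x => (l x).symm x

namespace IsDerivedPair

variable {X : Type u} {l σ : X → Equiv.Perm X}

/-- The permutation group generated by the `λ_x`. -/
abbrev LamGroup (l : X → Equiv.Perm X) : Subgroup (Equiv.Perm X) :=
  Subgroup.closure (Set.range l)

/-- The element `λ_x` of the group generated by the `λ_x`. -/
def lamGen (l : X → Equiv.Perm X) (x : X) : LamGroup l :=
  ⟨l x, Subgroup.subset_closure ⟨x, rfl⟩⟩

/-- The map `k ↦ k λ_{k⁻¹ (x)}`. If `k = λ_b` in a skew left brace, then it sends `λ_b` to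
`λ_{b + x}`. -/
def shift (l : X → Equiv.Perm X) (x : X) (k : LamGroup l) : LamGroup l :=
  k * lamGen l (k.1.symm x)

theorem equivariant_of_mem (h : IsDerivedPair l σ) {k : Equiv.Perm X} (hk : k ∈ LamGroup l)
    (v u : X) : k (σ v u) = σ (k v) (k u) := by
  induction hk using Subgroup.closure_induction generalizing v u with
  | mem k hk =>
    obtain ⟨a, rfl⟩ := hk
    exact h.equivariant a v u
  | one => rfl
  | mul k k' _ _ ih ih' =>
    rw [Equiv.Perm.mul_apply, ih', ih]
    rfl
  | inv k _ ih =>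
    rw [Equiv.Perm.inv_eq_iff_eq, ih]
    simp

theorem shift_injective (h : IsDerivedPair l σ) (x : X) : Function.Injective (shift l x) := by
  intro k k' e
  have e1 : k.1 * l (k.1.symm x) = k'.1 * l (k'.1.symm x) := congrArg Subtype.val e
  -- the arguments of `λ` have the same image under the diagonal map `u ↦ λ_u⁻¹ (u)`
  have e2 : k.1.symm x = k'.1.symm x := by
    apply h.diag_injective
    have e3 := congrArg (fun p : Equiv.Perm X => p.symm x) e1
    exact e3
  rw [e2] at e1
  exact Subtype.ext (mul_right_cancel e1)

/-- The shifts satisfy the relation `u + v = v + σ_v (u)` between the generators of the additive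
group, as right actions. -/
theorem shift_shift (h : IsDerivedPair l σ) (u v : X) (k : LamGroup l) :
    shift l v (shift l u k) = shift l (σ v u) (shift l v k) := by
  apply Subtype.ext
  have e := h.comm (k.1.symm u) (k.1.symm v)
  have e1 : σ (k.1.symm v) (k.1.symm u) = k.1.symm (σ v u) :=
    (h.equivariant_of_mem (inv_mem k.2) v u).symm
  rw [e1] at e
  change k.1 * l (k.1.symm u) * l ((l (k.1.symm u)).symm (k.1.symm v)) =
    k.1 * l (k.1.symm v) * l ((l (k.1.symm v)).symm (k.1.symm (σ v u)))
  rw [mul_assoc, e, mul_assoc]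

theorem shift_mul (k m : LamGroup l) (x : X) :
    shift l (k.1 x) (k * m) = k * shift l x m := by
  apply Subtype.ext
  change k.1 * m.1 * l (m.1.symm (k.1.symm (k.1 x))) = k.1 * (m.1 * l (m.1.symm x))
  rw [Equiv.symm_apply_apply, mul_assoc]

variable [Finite X]

/-- The generator of the additive group that corresponds to `x`: the inverse of the permutation
`(σ_x, shift_x)` of two sets. The inverse turns the right actions of the additive group into left
ones. -/
noncomputable def gen (h : IsDerivedPair l σ) (x : X) :
    Equiv.Perm X × Equiv.Perm (LamGroup l) :=
  (σ x, Equiv.ofBijective _ (Finite.injective_iff_bijective.1 (h.shift_injective x)))⁻¹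

/-- The group generated by the `λ_x` acts on `X`, and on itself by left translations. -/
def lamPair (l : X → Equiv.Perm X) : LamGroup l →* Equiv.Perm X × Equiv.Perm (LamGroup l) :=
  (LamGroup l).subtype.prod (MulAction.toPermHom (LamGroup l) (LamGroup l))

/-- The additive group: the permutation group generated by the elements `gen x`. -/
abbrev AddPart (h : IsDerivedPair l σ) : Subgroup (Equiv.Perm X × Equiv.Perm (LamGroup l)) :=
  Subgroup.closure (Set.range h.gen)

theorem lamPair_conj_gen (h : IsDerivedPair l σ) (k : LamGroup l) (x : X) :
    lamPair l k * h.gen x * (lamPair l k)⁻¹ = h.gen (k.1 x) := by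
  rw [gen, gen, ← inv_inj, inv_inv, mul_inv_rev, mul_inv_rev, inv_inv, inv_inv, ← mul_assoc,
    mul_inv_eq_iff_eq_mul]
  refine Prod.ext (Equiv.ext fun z => ?_) (Equiv.ext fun m => ?_)
  · exact h.equivariant_of_mem k.2 x z
  · exact (shift_mul k m x).symm

theorem gen_conj_gen (h : IsDerivedPair l σ) (v u : X) :
    (h.gen v)⁻¹ * h.gen u * h.gen v = h.gen (σ v u) := by
  rw [gen, gen, gen, inv_inv, ← inv_inj, inv_inv, mul_inv_rev, mul_inv_rev, inv_inv, inv_inv,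
    ← mul_assoc, mul_inv_eq_iff_eq_mul]
  refine Prod.ext (Equiv.ext fun z => ?_) (Equiv.ext fun m => ?_)
  · exact h.rack v u z
  · exact h.shift_shift u v m

theorem inv_mul_gen_mul (h : IsDerivedPair l σ) {b : Equiv.Perm X × Equiv.Perm (LamGroup l)}
    (hb : b ∈ h.AddPart) (x : X) : b⁻¹ * h.gen x * b = h.gen (b.1.symm x) := by
  induction hb using Subgroup.closure_induction generalizing x with
  | mem b hb =>
    obtain ⟨v, rfl⟩ := hb
    exact h.gen_conj_gen v x
  | one =>
    rw [inv_one, one_mul, mul_one]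
    rfl
  | mul b c _ _ hb hc =>
    have e : (b * c)⁻¹ * h.gen x * (b * c) = c⁻¹ * (b⁻¹ * h.gen x * b) * c := by group
    rw [e, hb, hc]
    rfl
  | inv b _ hb =>
    have e := hb (b.1 x)
    rw [Equiv.symm_apply_apply] at e
    change b⁻¹⁻¹ * h.gen x * b⁻¹ = h.gen (b.1 x)
    rw [← e]
    group

/-- The action of the group generated by the `λ_x` on the additive group. -/
def lamAct (h : IsDerivedPair l σ) (k : LamGroup l) : h.AddPart →* h.AddPart :=
  ((MulAut.conj (lamPair l k)).toMonoidHom.comp h.AddPart.subtype).codRestrict h.AddPart <| by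
    rintro ⟨b, hb⟩
    change lamPair l k * b * (lamPair l k)⁻¹ ∈ h.AddPart
    induction hb using Subgroup.closure_induction with
    | mem b hb =>
      obtain ⟨v, rfl⟩ := hb
      rw [lamPair_conj_gen]
      exact Subgroup.subset_closure ⟨_, rfl⟩
    | one => simp
    | mul b c _ _ hb hc => simpa [mul_assoc] using mul_mem hb hc
    | inv b _ hb => simpa [mul_assoc] using inv_mem hb

theorem coe_lamAct (h : IsDerivedPair l σ) (k : LamGroup l) (a : h.AddPart) :
    (h.lamAct k a : Equiv.Perm X × Equiv.Perm (LamGroup l)) =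
      lamPair l k * a * (lamPair l k)⁻¹ :=
  rfl

/-- The element `λ_a`, for an element `a` of the additive group: it is the image of `1` under the
right action of `a`. -/
def lamOf (h : IsDerivedPair l σ) (a : h.AddPart) : LamGroup l := a.1.2.symm 1

/-- The cocycle condition for `a ↦ λ_a`. -/
theorem lamOf_mul (h : IsDerivedPair l σ) (a b : h.AddPart) :
    h.lamOf (a * h.lamAct (h.lamOf a) b) = h.lamOf a * h.lamOf b := by
  change h.lamOf a * b.1.2.symm ((h.lamOf a)⁻¹ * h.lamOf a) = _
  rw [inv_mul_cancel]
  rfl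

/-- The skew left brace attached to a derived pair. -/
abbrev brace (h : IsDerivedPair l σ) : SkewLeftBrace (Additive h.AddPart) :=
  skewLeftBraceOfCocycle h.lamAct
    (fun a => Subtype.ext (by rw [coe_lamAct, map_one, one_mul, inv_one, mul_one]))
    (fun x y a => Subtype.ext (by
      rw [coe_lamAct, coe_lamAct, coe_lamAct, map_mul, mul_inv_rev]
      simp only [mul_assoc]))
    h.lamOf h.lamOf_mul

/-- The map from `X` to the skew left brace. -/
noncomputable def toBrace (h : IsDerivedPair l σ) (x : X) : Additive h.AddPart :=
  .ofMul ⟨h.gen x, Subgroup.subset_closure ⟨x, rfl⟩⟩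

theorem lam_brace (h : IsDerivedPair l σ) (a b : Additive h.AddPart) :
    letI := h.brace
    lam a b = .ofMul (h.lamAct (h.lamOf a.toMul) b.toMul) := by
  let _ := h.brace
  exact neg_add_cancel_left a (.ofMul (h.lamAct (h.lamOf a.toMul) b.toMul))

theorem lam_toBrace (h : IsDerivedPair l σ) (a : Additive h.AddPart) (y : X) :
    letI := h.brace
    lam a (h.toBrace y) = h.toBrace ((h.lamOf a.toMul).1 y) := by
  let _ := h.brace
  rw [lam_brace]
  exact congrArg Additive.ofMul (Subtype.ext (h.lamPair_conj_gen _ y))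

theorem lamOf_toBrace (h : IsDerivedPair l σ) (x : X) :
    h.lamOf (h.toBrace x).toMul = lamGen l x := by
  change shift l x 1 = _
  rw [shift, one_mul]
  rfl

theorem sig_toBrace (h : IsDerivedPair l σ) (b : Additive h.AddPart) (x : X) :
    letI := h.brace
    sig b (h.toBrace x) = h.toBrace (b.toMul.1.1.symm x) :=
  congrArg Additive.ofMul (Subtype.ext (h.inv_mul_gen_mul b.toMul.2 x))

theorem closure_range_toBrace (h : IsDerivedPair l σ) :
    AddSubgroup.closure (Set.range h.toBrace) = ⊤ := by
  rw [eq_top_iff]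
  rintro ⟨b, hb⟩ -
  change Additive.ofMul (⟨b, hb⟩ : h.AddPart) ∈ _
  induction hb using Subgroup.closure_induction with
  | mem b hb =>
    obtain ⟨v, rfl⟩ := hb
    exact AddSubgroup.subset_closure ⟨v, rfl⟩
  | one => exact AddSubgroup.zero_mem _
  | mul b c _ _ hb hc => exact AddSubgroup.add_mem _ hb hc
  | inv b _ hb => exact AddSubgroup.neg_mem _ hb

theorem exists_lamOf_eq (h : IsDerivedPair l σ) (k : LamGroup l) :
    ∃ a, h.lamOf a = k := by
  let _ := h.brace
  let κ : Additive h.AddPart →* LamGroup l :=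
    MonoidHom.mk' (fun a => h.lamOf a.toMul) (fun a b => h.lamOf_mul a.toMul b.toMul)
  suffices LamGroup l ≤ κ.range.map (LamGroup l).subtype by
    obtain ⟨_, ⟨a, rfl⟩, e⟩ := this k.2
    exact ⟨a.toMul, Subtype.ext e⟩
  refine (Subgroup.closure_le _).2 ?_
  rintro _ ⟨x, rfl⟩
  exact ⟨_, ⟨h.toBrace x, rfl⟩, congrArg Subtype.val (h.lamOf_toBrace x)⟩

/-- No non-zero ideal of the brace acts trivially on `X`. -/
theorem eq_bot_of_trivial (h : IsDerivedPair l σ) (hinj : Function.Injective h.toBrace) :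
    letI := h.brace
    ∀ I : AddSubgroup (Additive h.AddPart), IsIdeal I →
      (∀ b ∈ I, ∀ x, lam b (h.toBrace x) = h.toBrace x ∧ sig b (h.toBrace x) = h.toBrace x) →
        I = ⊥ := by
  let _ := h.brace
  intro I hI htriv
  rw [AddSubgroup.eq_bot_iff_forall]
  intro b hb
  have h1 : ∀ b ∈ I, h.lamOf b.toMul = 1 := by
    intro b hb
    apply Subtype.ext
    ext x
    have e := (htriv b hb x).1
    rw [lam_toBrace] at e
    exact hinj e
  have h2 : b.toMul.1.1 = 1 := by
    ext x
    have e := (htriv b hb (b.toMul.1.1 x)).2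
    rw [sig_toBrace, Equiv.symm_apply_apply] at e
    exact (hinj e).symm
  have h3 : b.toMul.1.2 = 1 := by
    ext1 k
    -- choose `a` with `λ_a = k⁻¹`; then `λ_a (b)` lies in `I`, hence acts trivially on `X`
    obtain ⟨a, ha⟩ := h.exists_lamOf_eq k⁻¹
    have e := h1 _ (hI.lam_mem (.ofMul a) hb)
    rw [lam_brace] at e
    change h.lamOf (h.lamAct (h.lamOf a) b.toMul) = 1 at e
    rw [ha] at e
    change k⁻¹ * b.toMul.1.2.symm (k⁻¹⁻¹ * 1) = 1 at e
    rw [inv_inv, mul_one, inv_mul_eq_one, Equiv.eq_symm_apply] at e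
    exact e
  exact congrArg Additive.ofMul (Subtype.ext (Prod.ext h2 h3))

/-- Elements of `X` with the same image in the brace have the same derived operation, as well as
the same `λ` after any element of the group generated by the maps `λ_x`. -/
theorem eq_of_toBrace_eq (h : IsDerivedPair l σ) {x y : X} (e : h.toBrace x = h.toBrace y) :
    σ x = σ y ∧ ∀ k ∈ LamGroup l, l (k x) = l (k y) := by
  have e1 : h.gen x = h.gen y := congrArg (fun a => (Additive.toMul a).1) e
  rw [gen, gen, inv_inj, Prod.mk.injEq] at e1
  refine ⟨e1.1, fun k hk => ?_⟩
  have e2 := congrArg Subtype.val (DFunLike.congr_fun e1.2 (⟨k, hk⟩⁻¹ : LamGroup l))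
  exact mul_left_cancel e2

end IsDerivedPair

/-! ### Simple solutions embed in skew left braces -/

section Components

variable {X : Type u} {r : X × X → X × X}

/-- The permutation `λ_x`. -/
noncomputable def IsNondegenerate.lamPerm (h : IsNondegenerate r) (x : X) : Equiv.Perm X :=
  .ofBijective _ (h.bijective_left x)

/-- The permutation `ρ_y`. -/
noncomputable def IsNondegenerate.rhoPerm (h : IsNondegenerate r) (y : X) : Equiv.Perm X :=
  .ofBijective _ (h.bijective_right y)

theorem IsSolution.isBraiding (hr : IsSolution r) (h : IsNondegenerate r) :
    IsBraiding h.lamPerm h.rhoPerm := by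
  have key : ∀ x y z, _ := fun x y z => congrFun hr.braid (x, y, z)
  simp only [Function.comp, leftMap, rightMap, Prod.mk.injEq] at key
  refine ⟨fun x y => Equiv.ext fun z => (key x y z).1,
    fun x y z => congrArg Prod.fst (key x y z).2, fun x y z => ?_⟩
  have e := congrArg Prod.snd (key x y z).2
  exact e

/-- The retraction of a simple solution that is not of Lyubashenko type is the solution itself. -/
theorem IsSimpleSolution.isIrretractable [Finite X] (hs : IsSimpleSolution r) (hr : IsSolution r)
    (h : IsNondegenerate r) (hL : ¬IsLyubashenko r) : IsIrretractable h.lamPerm h.rhoPerm := by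
  have hb := hr.isBraiding h
  let c : Setoid X := Setoid.ker (genPair h.lamPerm h.rhoPerm)
  have hc : ∀ x x' y y', c x x' → c y y' →
      c (r (x, y)).1 (r (x', y')).1 ∧ c (r (x, y)).2 (r (x', y')).2 := by
    intro x x' y y' hx hy
    change genPair h.lamPerm h.rhoPerm x = genPair h.lamPerm h.rhoPerm x' at hx
    change genPair h.lamPerm h.rhoPerm y = genPair h.lamPerm h.rhoPerm y' at hy
    have hl : h.lamPerm x = h.lamPerm x' := congrArg Prod.fst hx
    have hq : h.rhoPerm y = h.rhoPerm y' := MulOpposite.op_injective (congrArg Prod.snd hy)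
    change genPair h.lamPerm h.rhoPerm (h.lamPerm x y) =
        genPair h.lamPerm h.rhoPerm (h.lamPerm x' y') ∧
      genPair h.lamPerm h.rhoPerm (h.rhoPerm y x) = genPair h.lamPerm h.rhoPerm (h.rhoPerm y' x')
    constructor
    · rw [eq_mul_inv_of_mul_eq (hb.genPair_mul x y), hy, hq,
        ← eq_mul_inv_of_mul_eq (hb.genPair_mul x y'), hl]
    · rw [eq_inv_mul_of_mul_eq (hb.genPair_mul x y), hx, hl,
        ← eq_inv_mul_of_mul_eq (hb.genPair_mul x' y), hq]
  rcases hs.eq_or_forall hr c hc with htriv | hall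
  · intro x y h1 h2
    exact htriv x y (Prod.ext h1 (congrArg MulOpposite.op h2))
  · refine absurd ?_ hL
    obtain ⟨x₀⟩ := hr.nonempty
    have hl : ∀ x, h.lamPerm x = h.lamPerm x₀ := fun x => congrArg Prod.fst (hall x x₀)
    have hq : ∀ x, h.rhoPerm x = h.rhoPerm x₀ := fun x =>
      MulOpposite.op_injective (congrArg Prod.snd (hall x x₀))
    refine ⟨h.lamPerm x₀, h.rhoPerm x₀, ?_, fun x y => ?_⟩
    · refine Equiv.ext fun x => ?_
      have e := hb.mid x₀ x x₀
      simp only [hl, hq] at e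
      exact e.symm
    · rw [← hl x, ← hq y]
      rfl

theorem IsBraiding.isDerivedPair [Finite X] {l q : X → Equiv.Perm X} (h : IsBraiding l q)
    (hi : IsIrretractable l q) : IsDerivedPair l fun v =>
      .ofBijective _ (Finite.injective_iff_bijective.1 (h.derived_injective hi v)) where
  equivariant := h.l_derived
  rack := h.derived_derived
  comm u v := by
    obtain ⟨y, rfl⟩ := (l u).surjective v
    change l u * l ((l u).symm (l u y)) = l (l u y) * l ((l (l u y)).symm (derived l q (l u y) u))
    rw [Equiv.symm_apply_apply, derived_apply, Equiv.symm_apply_apply, h.left]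
  diag_injective := h.diag_injective hi

/-- A finite simple solution that is not of Lyubashenko type embeds in a finite skew left brace
without non-zero ideals that act trivially on it. -/
theorem IsSimpleSolution.exists_isBraceEmbedding [Finite X] (hs : IsSimpleSolution r)
    (hr : IsSolution r) (h : IsNondegenerate r) (hL : ¬IsLyubashenko r) :
    ∃ (B : Type u) (_ : SkewLeftBrace B) (_ : Finite B) (i : X → B), IsBraceEmbedding r i ∧
      ∀ I : AddSubgroup B, IsIdeal I →
        (∀ b ∈ I, ∀ x, lam b (i x) = i x ∧ sig b (i x) = i x) → I = ⊥ := by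
  have hb := hr.isBraiding h
  have hi := hs.isIrretractable hr h hL
  have hd := hb.isDerivedPair hi
  have hinj : Function.Injective hd.toBrace := by
    intro x y e
    obtain ⟨e1, e2⟩ := hd.eq_of_toBrace_eq e
    refine hi x y (e2 1 (one_mem _)) (Equiv.ext fun u => ?_)
    -- `ρ_x (u) = λ_v⁻¹ σ_v (u)` with `v = λ_u (x)`, and `σ_v = λ_u σ_x λ_u⁻¹`
    have e3 : derived h.lamPerm h.rhoPerm (h.lamPerm u x) u =
        derived h.lamPerm h.rhoPerm (h.lamPerm u y) u := by
      obtain ⟨z, hz⟩ := (h.lamPerm u).surjective u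
      have e4 := congrArg (h.lamPerm u) (DFunLike.congr_fun e1 z)
      change h.lamPerm u (derived h.lamPerm h.rhoPerm x z) =
        h.lamPerm u (derived h.lamPerm h.rhoPerm y z) at e4
      rwa [hb.l_derived, hb.l_derived, hz] at e4
    rw [q_eq_derived (l := h.lamPerm) u x, q_eq_derived (l := h.lamPerm) u y, e3,
      e2 _ (Subgroup.subset_closure ⟨u, rfl⟩)]
  let _ := hd.brace
  have : Finite (Additive hd.AddPart) := inferInstanceAs (Finite hd.AddPart)
  refine ⟨Additive hd.AddPart, hd.brace, this, hd.toBrace,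
    ⟨hinj, fun p => ?_, hd.closure_range_toBrace⟩, hd.eq_bot_of_trivial hinj⟩
  obtain ⟨x, y⟩ := p
  have e1 : ∀ x y, lam (hd.toBrace x) (hd.toBrace y) = hd.toBrace (h.lamPerm x y) := by
    intro x y
    rw [hd.lam_toBrace, hd.lamOf_toBrace]
    rfl
  have e2 : (r (x, y)).1 = h.lamPerm x y := rfl
  refine Prod.ext (e1 x y).symm ?_
  change hd.toBrace (h.rhoPerm y x) = (braceSolution _ (hd.toBrace x, hd.toBrace y)).2
  apply lam_injective (hd.toBrace (h.lamPerm x y))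
  rw [braceSolution_snd, e1, e1, lam_lam_inv, hd.sig_toBrace]
  exact congrArg hd.toBrace (derived_apply x y).symm

end Components

end YangBaxter

open YangBaxter
theorem mainTheorem3 {X : Type u} [Finite X] (r : X × X → X × X)
    (hsol : IsSolution r) (hnd : IsNondegenerate r) (hL : ¬ IsLyubashenko r) :
    IsSimpleSolution r ↔
      ∃ (B : Type u) (_ : SkewLeftBrace B) (_ : Finite B) (i : X → B),
        Function.Injective i ∧
        IsMorphism r (braceSolution B) i ∧
        AddSubgroup.closure (Set.range i) = ⊤ ∧
        IsLeast {I : AddSubgroup B | IsIdeal I ∧ I ≠ ⊥}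
          (idealClosure {b : B | ∃ x y : X, b = i x - i y}) ∧
        ActsTransitively (idealClosure {b : B | ∃ x y : X, b = i x - i y}) (Set.range i) := by
  constructor
  · intro hs
    obtain ⟨B, _, _, i, h, hfaithful⟩ := hs.exists_isBraceEmbedding hsol hnd hL
    have htrans : ∀ {I : AddSubgroup B}, IsIdeal I → I ≠ ⊥ →
        ActsTransitively I (Set.range i) :=
      fun hI hI0 => h.actsTransitively hnd hsol hs hfaithful hI hI0
    have hV := isIdeal_idealClosure {b : B | ∃ x y : X, b = i x - i y}
    have hV0 : idealClosure {b : B | ∃ x y : X, b = i x - i y} ≠ ⊥ := by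
      intro hV0
      -- otherwise `X` has a single element, and every solution on it is of Lyubashenko type
      have hsub : ∀ x y : X, x = y := by
        intro x y
        have e := subset_idealClosure {b : B | ∃ x y : X, b = i x - i y} ⟨x, y, rfl⟩
        rw [hV0, SetLike.mem_coe, AddSubgroup.mem_bot, sub_eq_zero] at e
        exact h.injective e
      exact hL ⟨1, 1, Commute.one_left 1, fun x y => Prod.ext (hsub _ _) (hsub _ _)⟩
    refine ⟨B, _, ‹_›, i, h.injective, h.isMorphism, h.closure_range,
      ⟨⟨hV, hV0⟩, fun I hI => idealClosure_le hI.1 ?_⟩, htrans hV hV0⟩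
    rintro _ ⟨x, y, rfl⟩
    -- elements of the same orbit of `I` are congruent modulo `I`
    have hxy : SameOrbit I (i y) (i x) := (htrans hI.1 hI.2).transitive _ ⟨y, rfl⟩ _ ⟨x, rfl⟩
    have e := hI.1.add_normal.conj_mem _ (hxy.neg_add_mem hI.1) (i y)
    rwa [add_neg_cancel_left, ← sub_eq_add_neg] at e
  · rintro ⟨B, _, _, i, hinj, hmor, hgen, hleast, htrans⟩
    exact IsBraceEmbedding.isSimpleSolution ⟨hinj, hmor, hgen⟩ hnd
      (fun I hI hI0 => hleast.2 ⟨hI, hI0⟩) htrans
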